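/- For an odd prime $p$ and integers $b,c$ let $$D_p(b,c)=\det\left[(i^2+bij+cj^2)^{p-2}\right]_{1\le i,j\le p-1}\in\mathbb Z ,$$ and let $\left(\frac{\cdot}{p}\right)$ denote the Legendre symbol. Then for every odd prime $p$, $$\left(\frac{D_p(2,-1)}{p}\right)=-1\iff p\equiv 5\pmod 8 .$$ -/

import Mathlib

/-- For `b c : ℤ` and `p : ℕ`, the integer
`D_p(b,c) = det [(i² + b i j + c j²)^(p-2)]_{1 ≤ i, j ≤ p-1}`.
The index `i : Fin (p - 1)` stands for the integer `i + 1`. -/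
def sunDet (p : ℕ) (b c : ℤ) : ℤ :=
  Matrix.det (Matrix.of fun i j : Fin (p - 1) =>
    (((i : ℕ) + 1 : ℤ) ^ 2 + b * ((i : ℕ) + 1 : ℤ) * ((j : ℕ) + 1 : ℤ)
      + c * ((j : ℕ) + 1 : ℤ) ^ 2) ^ (p - 2))

/-! ### Determinants of group matrices over a finite field. -/

open Finset

/-! Modulo p the power p-2 is inversion, and pulling ij out of each entry leaves a function of i/j,
so D is a nonzero square times the product of the moments T_k, k < p-1 (`sunDet_two_neg_one_cast`).
The symmetry u ↦ -1/u relates T_k to T_(p-1-k), so up to sign and squares only T_0 T_m survives, m =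
(p-1)/2 (`sunDet_cast_eq_of_odd`). If p ≡ 3 mod 4, the symmetry forces T_m = 0. Otherwise -1 is a
square, and partial fractions at the roots α, β = -1 ± √2 of x² + 2x - 1 evaluate the moments. For p
≡ 1 mod 8 the roots lie in the field and T_0 T_m = α^m/16 with α^m = ±1, a square. For p ≡ 5 mod 8
Frobenius swaps them, no moment vanishes, 4T_0 = 1 and (4T_m)² = -1; a square value would give an
element of order 8. -/

/-- The power moment `∑ g(u) u ^ n` over the units of a finite field. -/
def unitMoment {F : Type*} [Field F] [Fintype F] [DecidableEq F] (g : F → F) (n : ℕ) : F :=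
  ∑ u : Fˣ, g u * (u : F) ^ n

/-- The characters u ↦ u^k diagonalise the matrix: with `W` and `V` the Fourier matrix and its
inverse up to sign, `W * V = -1` and `W * M * V` is diagonal. Evenness of `N` removes the signs. -/
theorem det_groupMatrix_eq_prod_unitMoment {F : Type*} [Field F] [Fintype F] [DecidableEq F]
    (N : ℕ) (hN : Fintype.card F = N + 1) (hev : Even N) (e : Fin N ≃ Fˣ) (g : F → F) :
    (Matrix.of fun i j : Fin N => g ((e i : F) * (e j : F)⁻¹)).det
      = ∏ k ∈ range N, unitMoment g k := by
  set M := Matrix.of fun i j : Fin N => g ((e i : F) * (e j : F)⁻¹) with hM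
  let W : Matrix (Fin N) (Fin N) F := Matrix.of fun k i => (e i : F) ^ (k : ℕ)
  let V : Matrix (Fin N) (Fin N) F := Matrix.of fun i l => (e i : F) ^ (N - (l : ℕ))
  have horth : ∀ k l : Fin N,
      ∑ u : Fˣ, (u : F) ^ ((k : ℕ) + (N - (l : ℕ))) = if k = l then -1 else 0 := by
    intro k l
    have h := FiniteField.sum_pow_units F ((k : ℕ) + (N - (l : ℕ)))
    rw [h, hN]
    have hk := k.2
    have hl := l.2
    have : (N + 1 - 1 ∣ (k : ℕ) + (N - (l : ℕ))) ↔ k = l := by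
      rw [Nat.add_sub_cancel, Fin.ext_iff]
      constructor
      · rintro ⟨c, hc⟩
        have h1 : c < 2 := by
          by_contra! h2
          have : N * 2 ≤ N * c := Nat.mul_le_mul_left _ h2
          omega
        interval_cases c <;> omega
      · intro h
        exact ⟨1, by omega⟩
    simp only [this]
  have h1 : W * V = Matrix.diagonal fun _ => (-1 : F) := by
    ext k l
    rw [Matrix.mul_apply, Matrix.diagonal_apply, ← horth k l,
      ← e.sum_comp fun u : Fˣ => (u : F) ^ ((k : ℕ) + (N - (l : ℕ)))]
    simp [W, V, pow_add]
  have h2 : W * M * V = Matrix.diagonal fun k : Fin N => -unitMoment g k := by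
    ext k l
    have h3 : ∀ j, (W * M) k j = unitMoment g k * (e j : F) ^ (k : ℕ) := by
      intro j
      rw [Matrix.mul_apply, unitMoment, sum_mul,
        ← (e.trans (Equiv.mulRight (e j)⁻¹)).sum_comp]
      refine sum_congr rfl fun i _ => ?_
      have := (e j).ne_zero
      simp only [W, M, Matrix.of_apply, Equiv.trans_apply,
        Equiv.coe_mulRight, Units.val_mul, Units.val_inv_eq_inv_val, mul_pow, inv_pow]
      field_simp
    rw [Matrix.mul_apply, Matrix.diagonal_apply]
    simp only [h3]
    have h4 := horth k l
    rw [← e.sum_comp fun u : Fˣ => (u : F) ^ ((k : ℕ) + (N - (l : ℕ)))] at h4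
    calc ∑ j, unitMoment g k * (e j : F) ^ (k : ℕ) * V j l
        = unitMoment g k * ∑ j, (e j : F) ^ ((k : ℕ) + (N - (l : ℕ))) := by
          rw [mul_sum]
          exact sum_congr rfl fun j _ => by simp [V, pow_add, mul_assoc]
      _ = _ := by
          rw [h4]; split_ifs <;> simp
  have d1 := congrArg Matrix.det h1
  have d2 := congrArg Matrix.det h2
  rw [Matrix.det_mul, Matrix.det_diagonal] at d1 d2
  rw [Matrix.det_mul] at d2
  rw [prod_const, card_univ, Fintype.card_fin, hev.neg_one_pow] at d1
  rw [prod_neg, card_univ, Fintype.card_fin, hev.neg_one_pow, one_mul,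
    Fin.prod_univ_eq_prod_range] at d2
  rw [← d2]
  linear_combination (-M.det) * d1

/-! ### Reduction of the determinant modulo p. -/

/-- The units of `ZMod p` listed as `1, …, p - 1`. -/
noncomputable def finEquivUnitsZMod (p : ℕ) [Fact p.Prime] : Fin (p - 1) ≃ (ZMod p)ˣ :=
  Equiv.ofBijective
    (fun i => Units.mk0 (((i : ℕ) + 1 : ℕ) : ZMod p) (by
      rw [Ne, ZMod.natCast_eq_zero_iff]
      exact Nat.not_dvd_of_pos_of_lt (Nat.succ_pos _) (by have := i.2; omega)))
    ((Fintype.bijective_iff_injective_and_card _).2 ⟨by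
      intro i j h
      have h := congrArg Units.val h
      simp only [Units.val_mk0, ZMod.natCast_eq_natCast_iff'] at h
      have hi := i.2
      have hj := j.2
      rw [Nat.mod_eq_of_lt (by omega), Nat.mod_eq_of_lt (by omega)] at h
      exact Fin.ext (by omega), by
      rw [ZMod.card_units p, Fintype.card_fin]⟩)

theorem finEquivUnitsZMod_apply (p : ℕ) [Fact p.Prime] (i : Fin (p - 1)) :
    (finEquivUnitsZMod p i : ZMod p) = (i : ℕ) + 1 := by
  simp [finEquivUnitsZMod]

theorem ZMod.pow_prime_sub_two {p : ℕ} [Fact p.Prime] (hp : p ≠ 2) (y : ZMod p) :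
    y ^ (p - 2) = y⁻¹ := by
  have h2 := (Fact.out : p.Prime).two_le
  by_cases hy : y = 0
  · subst hy
    rw [zero_pow (by omega), inv_zero]
  · apply eq_inv_of_mul_eq_one_left
    rw [← pow_succ, show p - 2 + 1 = p - 1 by omega, ZMod.pow_card_sub_one_eq_one hy]

/-- The power moments of `u ↦ (u + 2 - u⁻¹)⁻¹`. -/
def pellMoment (p : ℕ) [Fact p.Prime] (n : ℕ) : ZMod p :=
  unitMoment (fun x : ZMod p => (x + 2 - x⁻¹)⁻¹) n

theorem sunDet_two_neg_one_cast (p : ℕ) [Fact p.Prime] (hp : Odd p) :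
    ∃ s : ZMod p, s ≠ 0 ∧
      (sunDet p 2 (-1) : ZMod p) = s ^ 2 * ∏ k ∈ range (p - 1), pellMoment p k := by
  have h2 : p ≠ 2 := by rintro rfl; exact absurd hp (by decide)
  have hpos := (Fact.out : p.Prime).pos
  let e := finEquivUnitsZMod p
  refine ⟨∏ i, (e i : ZMod p)⁻¹, prod_ne_zero_iff.2 fun i _ => inv_ne_zero (e i).ne_zero, ?_⟩
  rw [sq]
  simp only [pellMoment]
  rw [← det_groupMatrix_eq_prod_unitMoment (p - 1) (by rw [ZMod.card]; omega)
    (Nat.Odd.sub_odd hp odd_one) e, sunDet, Int.cast_det, mul_assoc, ← Matrix.det_mul_row, ← Matrix.det_mul_column]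
  congr 1
  ext i j
  have hi := (e i).ne_zero
  have hj := (e j).ne_zero
  have hi' : (e i : ZMod p) = (i : ℕ) + 1 := finEquivUnitsZMod_apply p i
  have hj' : (e j : ZMod p) = (j : ℕ) + 1 := finEquivUnitsZMod_apply p j
  simp only [Matrix.map_apply, Matrix.of_apply]
  push_cast
  rw [← hi', ← hj', ZMod.pow_prime_sub_two h2, ← mul_inv, ← mul_inv]
  congr 1
  field_simp
  ring

/-- The substitution u ↦ -u⁻¹ fixes u + 2 - u⁻¹. -/
theorem pellMoment_reflect (p : ℕ) [Fact p.Prime] {n : ℕ} (hn : n ≤ p - 1) :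
    pellMoment p (p - 1 - n) = (-1) ^ n * pellMoment p n := by
  rw [pellMoment, pellMoment, unitMoment, unitMoment, mul_sum,
    ← ((Equiv.inv (ZMod p)ˣ).trans (Equiv.neg _)).sum_comp]
  refine sum_congr rfl fun u _ => ?_
  have hu := u.ne_zero
  have h1 : (-((u : ZMod p)⁻¹)) ^ (p - 1 - n) = (-1) ^ n * (u : ZMod p) ^ n := by
    have h : (-((u : ZMod p)⁻¹)) ^ (p - 1 - n) * (-((u : ZMod p)⁻¹)) ^ n = 1 := by
      rw [← pow_add, Nat.sub_add_cancel hn]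
      exact ZMod.pow_card_sub_one_eq_one (neg_ne_zero.2 (inv_ne_zero hu))
    have h' : (-((u : ZMod p)⁻¹)) ^ n * ((-1) ^ n * (u : ZMod p) ^ n) = 1 := by
      rw [← mul_pow, ← mul_pow, neg_one_mul, neg_mul_neg, inv_mul_cancel₀ hu, one_pow]
    calc _ = (-((u : ZMod p)⁻¹)) ^ (p - 1 - n) *
          ((-((u : ZMod p)⁻¹)) ^ n * ((-1) ^ n * (u : ZMod p) ^ n)) := by rw [h', mul_one]
      _ = _ := by rw [← mul_assoc, h, one_mul]
  have hv : ((((Equiv.inv (ZMod p)ˣ).trans (Equiv.neg _)) u : (ZMod p)ˣ) : ZMod p)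
      = -((u : ZMod p)⁻¹) :=
    (Units.val_neg u⁻¹).trans (congrArg Neg.neg (Units.val_inv_eq_inv_val u))
  rw [hv, h1, inv_neg, inv_inv,
    show -(u : ZMod p)⁻¹ + 2 - -(u : ZMod p) = u + 2 - (u : ZMod p)⁻¹ by ring]
  ring

theorem prod_range_two_mul_of_reflect {R : Type*} [CommRing R] (T : ℕ → R) {m : ℕ} (hm : 0 < m)
    (hT : ∀ n ≤ 2 * m, T (2 * m - n) = (-1) ^ n * T n) :
    ∃ a : ℕ, ∏ k ∈ range (2 * m), T k
      = (-1) ^ a * (∏ k ∈ range (m - 1), T (k + 1)) ^ 2 * T 0 * T m := by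
  obtain ⟨r, rfl⟩ : ∃ r, m = r + 1 := ⟨m - 1, by omega⟩
  have h : ∏ j ∈ range r, T (r + 1 + (j + 1)) = ∏ j ∈ range r, ((-1) ^ (j + 1) * T (j + 1)) := by
    rw [← prod_range_reflect]
    refine prod_congr rfl fun j hj => ?_
    have := mem_range.1 hj
    rw [← hT (j + 1) (by omega)]
    congr 1
    omega
  refine ⟨∑ j ∈ range r, (j + 1), ?_⟩
  rw [two_mul, prod_range_add, prod_range_succ', prod_range_succ' (fun j => T (r + 1 + j)), h,
    prod_mul_distrib, prod_pow_eq_pow_sum]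
  simp only [Nat.add_sub_cancel, Nat.add_zero]
  ring

/-! ### Evaluation of the moments by partial fractions. -/

/-- Among exponents k < p only k = p-1 has a nonzero power sum, and it occurs only for n = p. -/
theorem sum_geom_eq {p : ℕ} [Fact p.Prime] {K : Type*} [Field K] [Algebra (ZMod p) K] (α : K)
    {n : ℕ} (hn : n ≤ p) :
    ∑ x : ZMod p, ∑ k ∈ range n, (algebraMap (ZMod p) K x) ^ k * α ^ (n - 1 - k)
      = if n = p then -1 else 0 := by
  have hpos := (Fact.out : p.Prime).two_le
  have hs : ∀ k < p, ∑ x : ZMod p, (algebraMap (ZMod p) K x) ^ k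
      = if k = p - 1 then -1 else 0 := by
    intro k hk
    simp only [← map_pow, ← map_sum]
    split_ifs with h
    · subst h
      have h1 : ∀ x : ZMod p, x ^ (p - 1) = 1 - if x = 0 then 1 else 0 := by
        intro x
        split_ifs with h
        · rw [h, zero_pow (by omega), sub_self]
        · rw [ZMod.pow_card_sub_one_eq_one h, sub_zero]
      simp [h1]
    · rw [FiniteField.sum_pow_lt_card_sub_one (ZMod p) k (by rw [ZMod.card]; omega), map_zero]
  rw [sum_comm]
  simp only [← sum_mul]
  rw [sum_congr rfl fun k hk => by rw [hs k ((mem_range.1 hk).trans_le hn)]]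
  split_ifs with h
  · subst h
    rw [sum_eq_single (n - 1)]
    · simp
    · intro b _ hb; simp [hb]
    · intro h; exact absurd (mem_range.2 (by omega)) h
  · refine sum_eq_zero fun k hk => ?_
    have := mem_range.1 hk
    rw [if_neg (by omega), zero_mul]

theorem pellMoment_eq_sum (p : ℕ) [Fact p.Prime] (n : ℕ) :
    pellMoment p n = ∑ x : ZMod p, x ^ (n + 1) * (x ^ 2 + 2 * x - 1)⁻¹ := by
  refine Fintype.sum_of_injective (fun u : (ZMod p)ˣ => (u : ZMod p)) Units.val_injective _ _ ?_ ?_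
  · intro x hx
    have : x = 0 := by
      by_contra h
      exact hx ⟨Units.mk0 x h, rfl⟩
    simp [this]
  · intro u
    have hu := u.ne_zero
    simp only [pow_succ]
    field_simp

theorem sum_pow_mul_inv_sub_of_notMem {p : ℕ} [Fact p.Prime] {K : Type*} [Field K]
    [Algebra (ZMod p) K] {α β : K} (hα : α ^ p = β) (hne : α ≠ β) {n : ℕ} (hn : n < p) :
    ∑ x : ZMod p, (algebraMap (ZMod p) K x) ^ n * (algebraMap (ZMod p) K x - α)⁻¹
      = α ^ n * (β - α)⁻¹ := by
  have hp0 : (p : K) = 0 := by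
    rw [← map_natCast (algebraMap (ZMod p) K), ZMod.natCast_self, map_zero]
  have hx : ∀ x : ZMod p, algebraMap (ZMod p) K x - α ≠ 0 := by
    intro x h
    apply hne
    rw [← hα, ← sub_eq_zero.1 h, ← map_pow, ZMod.pow_card]
  have hs := sub_ne_zero.2 hne
  have hs' := sub_ne_zero.2 hne.symm
  -- Since x^p = x, the geometric sum is (x - β)/(x - α) = 1 + (α - β)/(x - α), so the inverse is a
  -- polynomial in x.
  have h1 : ∀ x : ZMod p, (algebraMap (ZMod p) K x - α)⁻¹
      = (α - β)⁻¹ * (∑ k ∈ range p, (algebraMap (ZMod p) K x) ^ k * α ^ (p - 1 - k) - 1) := by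
    intro x
    have h := geom_sum₂_mul (algebraMap (ZMod p) K x) α p
    rw [hα, ← map_pow, ZMod.pow_card] at h
    have := hx x
    field_simp
    linear_combination -h
  have h2 : ∀ x : ZMod p, (algebraMap (ZMod p) K x) ^ n * (algebraMap (ZMod p) K x - α)⁻¹
      = ∑ k ∈ range n, (algebraMap (ZMod p) K x) ^ k * α ^ (n - 1 - k)
        + α ^ n * (algebraMap (ZMod p) K x - α)⁻¹ := by
    intro x
    have h := geom_sum₂_mul (algebraMap (ZMod p) K x) α n
    have := hx x
    field_simp
    linear_combination -h
  rw [sum_congr rfl fun x _ => h2 x, sum_add_distrib, sum_geom_eq α hn.le, if_neg hn.ne,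
    ← mul_sum, sum_congr rfl fun x _ => h1 x, ← mul_sum, sum_sub_distrib, sum_geom_eq α le_rfl,
    if_pos rfl, sum_const, card_univ, ZMod.card, nsmul_eq_mul, hp0]
  field_simp
  ring

theorem pellMoment_of_notMem {p : ℕ} [Fact p.Prime] {K : Type*} [Field K]
    [Algebra (ZMod p) K] {α β : K} (hα : α ^ p = β) (hβ : β ^ p = α) (hne : α ≠ β)
    (hadd : α + β = -2) (hmul : α * β = -1) {n : ℕ} (hn : n + 1 < p) :
    8 * algebraMap (ZMod p) K (pellMoment p n) = -(α ^ (n + 1) + β ^ (n + 1)) := by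
  have hs := sub_ne_zero.2 hne
  have hs' := sub_ne_zero.2 hne.symm
  have h8 : (α - β) ^ 2 = 8 := by linear_combination (α + β - 2) * hadd - 4 * hmul
  have h1 : ∀ x : ZMod p, (algebraMap (ZMod p) K x) ^ (n + 1)
        * (algebraMap (ZMod p) K x ^ 2 + 2 * algebraMap (ZMod p) K x - 1)⁻¹
      = (α - β)⁻¹ * ((algebraMap (ZMod p) K x) ^ (n + 1) * (algebraMap (ZMod p) K x - α)⁻¹
        - (algebraMap (ZMod p) K x) ^ (n + 1) * (algebraMap (ZMod p) K x - β)⁻¹) := by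
    intro x
    have hxα : algebraMap (ZMod p) K x - α ≠ 0 := by
      intro h
      apply hne
      rw [← hα, ← sub_eq_zero.1 h, ← map_pow, ZMod.pow_card]
    have hxβ : algebraMap (ZMod p) K x - β ≠ 0 := by
      intro h
      apply hne
      rw [← hβ, ← sub_eq_zero.1 h, ← map_pow, ZMod.pow_card]
    have hf : algebraMap (ZMod p) K x ^ 2 + 2 * algebraMap (ZMod p) K x - 1
        = (algebraMap (ZMod p) K x - α) * (algebraMap (ZMod p) K x - β) := by
      linear_combination algebraMap (ZMod p) K x * hadd - hmul
    rw [hf]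
    field_simp
    ring
  rw [pellMoment_eq_sum]
  simp only [map_sum, map_mul, map_pow, map_inv₀, map_sub, map_add, map_one, map_ofNat]
  rw [sum_congr rfl fun x _ => h1 x, ← mul_sum, sum_sub_distrib,
    sum_pow_mul_inv_sub_of_notMem hα hne hn, sum_pow_mul_inv_sub_of_notMem hβ hne.symm hn, ← h8]
  field_simp
  ring

theorem sum_pow_mul_inv_sub {p : ℕ} [Fact p.Prime] (hp : p ≠ 2) (α : ZMod p) {n : ℕ}
    (hn : n < p) :
    ∑ x : ZMod p, x ^ n * (x - α)⁻¹ = -(n * α ^ (n - 1)) := by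
  have h2 := (Fact.out : p.Prime).two_le
  -- With 0⁻¹ = 0, x ↦ (x - α)⁻¹ permutes the field.
  have h0 : ∑ x : ZMod p, (x - α)⁻¹ = 0 := by
    refine (((Equiv.subRight α).trans (inv_involutive (G := ZMod p)).toPerm).sum_comp
      fun x => x).trans ?_
    simpa using FiniteField.sum_pow_lt_card_sub_one (ZMod p) 1 (by rw [ZMod.card]; omega)
  -- At x = α the left side is 0 by convention, while the geometric sum is n α^(n-1).
  have h1 : ∀ x : ZMod p, x ^ n * (x - α)⁻¹ = ∑ k ∈ range n, x ^ k * α ^ (n - 1 - k)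
      + α ^ n * (x - α)⁻¹ - if x = α then n * α ^ (n - 1) else 0 := by
    intro x
    split_ifs with h
    · subst h
      have : ∀ k ∈ range n, x ^ k * x ^ (n - 1 - k) = x ^ (n - 1) := by
        intro k hk
        have := mem_range.1 hk
        rw [← pow_add]
        congr 1
        omega
      rw [sum_congr rfl this]
      simp
    · have h := geom_sum₂_mul x α n
      have : x - α ≠ 0 := sub_ne_zero.2 (by assumption)
      field_simp
      linear_combination -h
  have h3 := sum_geom_eq (p := p) (K := ZMod p) α hn.le
  simp only [Algebra.algebraMap_self, RingHom.id_apply, if_neg hn.ne] at h3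
  rw [sum_congr rfl fun x _ => h1 x, sum_sub_distrib, sum_add_distrib, h3, ← mul_sum, h0]
  simp

/-- As α^n = β^n, the two partial fraction sums cancel; only the corrections at the poles, where 0⁻¹
= 0, contribute. -/
theorem pellMoment_of_mem {p : ℕ} [Fact p.Prime] (hp : p ≠ 2) {α β ε : ZMod p} (hne : α ≠ β)
    (hadd : α + β = -2) (hmul : α * β = -1) {n : ℕ} (hn : n + 1 < p) (hα : α ^ n = ε)
    (hβ : β ^ n = ε) : 8 * pellMoment p n = -2 * ε := by
  have hs := sub_ne_zero.2 hne
  have hs' := sub_ne_zero.2 hne.symm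
  have h8 : (α - β) ^ 2 = 8 := by linear_combination (α + β - 2) * hadd - 4 * hmul
  have h1 : ∀ x : ZMod p, x ^ (n + 1) * (x ^ 2 + 2 * x - 1)⁻¹
      = (α - β)⁻¹ * (x ^ (n + 1) * (x - α)⁻¹ - x ^ (n + 1) * (x - β)⁻¹)
        + (if x = α then α ^ (n + 1) * ((α - β) ^ 2)⁻¹ else 0)
        + (if x = β then β ^ (n + 1) * ((α - β) ^ 2)⁻¹ else 0) := by
    intro x
    have hf : x ^ 2 + 2 * x - 1 = (x - α) * (x - β) := by
      linear_combination x * hadd - hmul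
    rw [hf]
    by_cases hxα : x = α
    · subst hxα
      simp only [sub_self, zero_mul, inv_zero, mul_zero, if_true, if_neg hne]
      field_simp
      ring
    by_cases hxβ : x = β
    · subst hxβ
      simp only [sub_self, mul_zero, inv_zero, if_true, if_neg hne.symm]
      field_simp
      ring
    rw [if_neg hxα, if_neg hxβ]
    have h3 := sub_ne_zero.2 hxα
    have h4 := sub_ne_zero.2 hxβ
    field_simp
    ring
  rw [pellMoment_eq_sum, sum_congr rfl fun x _ => h1 x, sum_add_distrib, sum_add_distrib,
    ← mul_sum, sum_sub_distrib, sum_pow_mul_inv_sub hp α hn, sum_pow_mul_inv_sub hp β hn,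
    sum_ite_eq' univ α, sum_ite_eq' univ β, if_pos (mem_univ _), if_pos (mem_univ _), ← h8,
    Nat.add_sub_cancel, pow_succ α, pow_succ β, hα, hβ]
  field_simp
  linear_combination ε * hadd

/-! ### The square class of the determinant by residue of p. -/

theorem sunDet_cast_eq_of_odd {p m : ℕ} [Fact p.Prime] (hm : p = 2 * m + 1) :
    ∃ (a : ℕ) (s : ZMod p), (sunDet p 2 (-1) : ZMod p)
        = (-1) ^ a * s ^ 2 * pellMoment p 0 * pellMoment p m ∧
      ((∀ n, n + 1 < p → pellMoment p n ≠ 0) → s ≠ 0) := by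
  have h2 := (Fact.out : p.Prime).two_le
  have hp : p - 1 = 2 * m := by omega
  obtain ⟨s, hs, hD⟩ := sunDet_two_neg_one_cast p ⟨m, hm⟩
  obtain ⟨a, ha⟩ := prod_range_two_mul_of_reflect (pellMoment p) (m := m) (by omega)
    fun n hn => hp ▸ pellMoment_reflect p (hp ▸ hn)
  refine ⟨a, s * ∏ k ∈ range (m - 1), pellMoment p (k + 1), ?_, fun h => ?_⟩
  · rw [hD, hp, ha]
    ring
  · refine mul_ne_zero hs (prod_ne_zero_iff.2 fun k hk => h _ ?_)
    have := mem_range.1 hk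
    omega

theorem ZMod.two_ne_zero_of_odd_prime {p : ℕ} [Fact p.Prime] (hp : p ≠ 2) : (2 : ZMod p) ≠ 0 :=
  Ring.two_ne_zero (by rwa [ZMod.ringChar_zmod_n])

theorem isSquare_sunDet_of_mod_four_eq_three {p : ℕ} [Fact p.Prime] (hp : p % 4 = 3) :
    IsSquare (sunDet p 2 (-1) : ZMod p) := by
  obtain ⟨m, hm⟩ : ∃ m, p = 2 * m + 1 := ⟨p / 2, by omega⟩
  obtain ⟨a, s, hD, -⟩ := sunDet_cast_eq_of_odd hm
  have h := pellMoment_reflect p (n := m) (by omega)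
  rw [show p - 1 - m = m by omega, Odd.neg_one_pow (Nat.odd_iff.2 (by omega)), neg_one_mul] at h
  have h0 : pellMoment p m = 0 := by
    have h' : (2 : ZMod p) * pellMoment p m = 0 := by linear_combination h
    exact (mul_eq_zero.1 h').resolve_left (ZMod.two_ne_zero_of_odd_prime (by omega))
  rw [hD, h0, mul_zero]
  exact IsSquare.zero

theorem isSquare_sunDet_of_mod_eight_eq_one {p : ℕ} [Fact p.Prime] (hp : p % 8 = 1) :
    IsSquare (sunDet p 2 (-1) : ZMod p) := by
  have h1 := (Fact.out : p.Prime).two_le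
  have hp2 : p ≠ 2 := by omega
  obtain ⟨m, hm⟩ : ∃ m, p = 2 * m + 1 := ⟨p / 2, by omega⟩
  obtain ⟨a, s, hD, -⟩ := sunDet_cast_eq_of_odd hm
  have h2 := ZMod.two_ne_zero_of_odd_prime hp2
  have hneg : IsSquare (-1 : ZMod p) := ZMod.exists_sq_eq_neg_one_iff.2 (by omega)
  obtain ⟨r, hr⟩ := (ZMod.exists_sq_eq_two_iff hp2).2 (Or.inl hp)
  have hr0 : r ≠ 0 := by
    rintro rfl
    exact h2 (by rw [hr, mul_zero])
  have hmul : (-1 + r) * (-1 - r) = -1 := by linear_combination hr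
  have hadd : (-1 + r) + (-1 - r) = -2 := by ring
  have hne : -1 + r ≠ -1 - r := by
    intro h
    exact mul_ne_zero h2 hr0 (by linear_combination h)
  have hα : -1 + r ≠ 0 := by
    intro h
    rw [h, zero_mul] at hmul
    exact one_ne_zero (neg_eq_zero.1 hmul.symm)
  have hε : ((-1 + r) ^ m) * ((-1 + r) ^ m) = 1 := by
    rw [← pow_add, show m + m = p - 1 by omega, ZMod.pow_card_sub_one_eq_one hα]
  have hε' : (-1 - r) ^ m = (-1 + r) ^ m := by
    have h : (-1 + r) ^ m * (-1 - r) ^ m = 1 := by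
      rw [← mul_pow, hmul, Even.neg_one_pow (Nat.even_iff.2 (by omega))]
    calc _ = ((-1 + r) ^ m * (-1 + r) ^ m) * (-1 - r) ^ m := by rw [hε, one_mul]
      _ = _ := by rw [mul_assoc, h, mul_one]
  have hT0 := pellMoment_of_mem hp2 hne hadd hmul (n := 0) (by omega) (pow_zero _) (pow_zero _)
  have hTm := pellMoment_of_mem hp2 hne hadd hmul (n := m) (by omega) rfl hε'
  have hsq : IsSquare ((-1 + r) ^ m) := by
    rcases mul_self_eq_one_iff.1 hε with h | h <;> rw [h]
    · exact IsSquare.one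
    · exact hneg
  have hTT : pellMoment p 0 * pellMoment p m = ((4 : ZMod p)⁻¹) ^ 2 * (-1 + r) ^ m := by
    have h4 : (4 : ZMod p) ≠ 0 := by
      rw [show (4 : ZMod p) = 2 * 2 by norm_num]
      exact mul_ne_zero h2 h2
    rw [inv_pow, ← div_eq_inv_mul, eq_div_iff (pow_ne_zero 2 h4)]
    have h64 : (4 : ZMod p) * (pellMoment p 0 * pellMoment p m * 4 ^ 2 - (-1 + r) ^ m) = 0 := by
      linear_combination 8 * pellMoment p m * hT0 - 2 * hTm
    exact sub_eq_zero.1 ((mul_eq_zero.1 h64).resolve_left h4)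
  rw [hD, mul_assoc, hTT]
  exact ((hneg.pow a).mul (IsSquare.sq s)).mul ((IsSquare.sq _).mul hsq)

theorem not_isSquare_sunDet_of_mod_eight_eq_five {p : ℕ} [Fact p.Prime] (hp : p % 8 = 5) :
    ¬IsSquare (sunDet p 2 (-1) : ZMod p) := by
  have h1 := (Fact.out : p.Prime).two_le
  have hp2 : p ≠ 2 := by omega
  obtain ⟨m, hm⟩ : ∃ m, p = 2 * m + 1 := ⟨p / 2, by omega⟩
  obtain ⟨a, s, hD, hs⟩ := sunDet_cast_eq_of_odd hm
  have h2 := ZMod.two_ne_zero_of_odd_prime hp2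
  have hneg : IsSquare (-1 : ZMod p) := ZMod.exists_sq_eq_neg_one_iff.2 (by omega)
  let K := AlgebraicClosure (ZMod p)
  have hinj : Function.Injective (algebraMap (ZMod p) K) := (algebraMap (ZMod p) K).injective
  have : CharP K p := charP_of_injective_algebraMap hinj p
  have h2K : (2 : K) ≠ 0 := by
    rw [← map_ofNat (algebraMap (ZMod p) K) 2]
    exact (map_ne_zero _).2 h2
  obtain ⟨r, hr⟩ := IsAlgClosed.exists_pow_nat_eq (2 : K) (n := 2) (by norm_num)
  have hr0 : r ≠ 0 := by
    rintro rfl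
    exact h2K (by rw [← hr]; ring)
  have hpow2 : (2 : ZMod p) ^ m = -1 := by
    have h := ZMod.pow_div_two_eq_neg_one_or_one p h2
    rw [show p / 2 = m by omega] at h
    refine h.resolve_left fun h => ?_
    have h' := (ZMod.exists_sq_eq_two_iff hp2).1
      ((ZMod.euler_criterion p h2).2 (by rwa [show p / 2 = m by omega]))
    omega
  have hrp : r ^ p = -r := by
    have h := congrArg (algebraMap (ZMod p) K) hpow2
    rw [map_pow, map_neg, map_one, map_ofNat] at h
    calc r ^ p = r ^ (2 * m + 1) := congrArg (r ^ ·) hm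
      _ = -r := by rw [pow_succ, pow_mul, hr, h, neg_one_mul]
  have hodd : Odd p := ⟨m, hm⟩
  obtain ⟨α, hα⟩ : ∃ α, α = -1 + r := ⟨_, rfl⟩
  obtain ⟨β, hβ⟩ : ∃ β, β = -1 - r := ⟨_, rfl⟩
  have hmul : α * β = -1 := by rw [hα, hβ]; linear_combination -hr
  have hadd : α + β = -2 := by rw [hα, hβ]; ring
  have hne : α ≠ β := by
    intro h
    exact mul_ne_zero h2K hr0 (by linear_combination h - hα + hβ)
  have hαp : α ^ p = β := by
    rw [hα, hβ, add_pow_char, hrp, hodd.neg_one_pow, ← sub_eq_add_neg]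
  have hβp : β ^ p = α := by
    rw [hα, hβ, sub_pow_char, hrp, hodd.neg_one_pow, sub_neg_eq_add]
  have hT : ∀ n, n + 1 < p → 8 * algebraMap (ZMod p) K (pellMoment p n)
      = -(α ^ (n + 1) + β ^ (n + 1)) := fun n hn =>
    pellMoment_of_notMem hαp hβp hne hadd hmul hn
  have hm1 : Odd (m + 1) := Nat.odd_iff.2 (by omega)
  have hα2 : α ^ (2 * (m + 1)) = -1 := by
    rw [show 2 * (m + 1) = p + 1 by omega, pow_succ, hαp, mul_comm, hmul]
  have hβ2 : β ^ (2 * (m + 1)) = -1 := by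
    rw [show 2 * (m + 1) = p + 1 by omega, pow_succ, hβp, hmul]
  have hne0 : ∀ n, n + 1 < p → pellMoment p n ≠ 0 := by
    intro n hn h0
    have h := hT n hn
    rw [h0, map_zero, mul_zero] at h
    -- T_n = 0 means α^(n+1) = -β^(n+1); multiply by α^(n+1). Raising to the odd power m+1 then
    -- contradicts α^(2(m+1)) = αβ = -1.
    have h3 : α ^ (2 * (n + 1)) = -(-1) ^ (n + 1) := by
      rw [← hmul, mul_pow, two_mul, pow_add]
      linear_combination α ^ (n + 1) * h
    have h4 := congrArg (· ^ (m + 1)) h3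
    simp only [hm1.neg_pow] at h4
    rw [← pow_mul, ← pow_mul, show 2 * (n + 1) * (m + 1) = 2 * (m + 1) * (n + 1) by ring, pow_mul,
      hα2, mul_comm (n + 1), pow_mul, hm1.neg_one_pow] at h4
    have h5 : (2 : K) * (-1) ^ (n + 1) = 0 := by linear_combination h4
    exact mul_ne_zero h2K (pow_ne_zero _ (neg_ne_zero.2 one_ne_zero)) h5
  have h2' : ∀ {x : ZMod p}, 2 * x = 0 → x = 0 := fun h => (mul_eq_zero.1 h).resolve_left h2
  have hT0 : 4 * pellMoment p 0 = 1 := by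
    have h : 2 * (4 * pellMoment p 0 - 1) = 0 := by
      apply hinj
      simp only [map_mul, map_sub, map_ofNat, map_one, map_zero]
      linear_combination hT 0 (by omega) - hadd
    exact sub_eq_zero.1 (h2' h)
  have hTm : (4 * pellMoment p m) ^ 2 = -1 := by
    have h : 2 * (2 * ((4 * pellMoment p m) ^ 2 + 1)) = 0 := by
      apply hinj
      have h5 := congrArg (· ^ 2) (hT m (by omega))
      have h6 : α ^ (m + 1) * β ^ (m + 1) = -1 := by rw [← mul_pow, hmul, hm1.neg_one_pow]
      simp only [map_mul, map_add, map_pow, map_ofNat, map_one, map_zero]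
      rw [mul_comm, pow_mul] at hα2 hβ2
      linear_combination h5 + hα2 + hβ2 + 2 * h6
    exact eq_neg_of_add_eq_zero_left (h2' (h2' h))
  rintro ⟨w, hw⟩
  obtain ⟨j, hj⟩ := hneg.pow a
  have hj0 : j ≠ 0 := by
    rintro rfl
    rw [mul_zero] at hj
    exact pow_ne_zero _ (neg_ne_zero.2 one_ne_zero) hj
  have hs0 := hs hne0
  have hv : (4 * w / (j * s)) ^ 2 = 4 * pellMoment p m := by
    rw [div_pow, div_eq_iff (pow_ne_zero 2 (mul_ne_zero hj0 hs0))]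
    rw [hD, hj] at hw
    linear_combination -16 * hw + 4 * j ^ 2 * s ^ 2 * pellMoment p m * hT0
  have hv4 : (4 * w / (j * s)) ^ 4 = -1 := by
    rw [show 4 = 2 * 2 from rfl, pow_mul]
    rw [hv, hTm]
  have hv0 : 4 * w / (j * s) ≠ 0 := by
    intro h
    rw [h, zero_pow (by norm_num)] at hv4
    exact one_ne_zero (neg_eq_zero.1 hv4.symm)
  have hfin := ZMod.pow_card_sub_one_eq_one hv0
  -- For p ≡ 5 mod 8 the quotient (p-1)/4 is odd, so Fermat gives -1 = 1.
  rw [show p - 1 = 4 * (p / 4) by omega, pow_mul, hv4,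
    Odd.neg_one_pow (Nat.odd_iff.2 (by omega))] at hfin
  exact h2 (by linear_combination -hfin)

theorem mainTheorem5 (p : ℕ) [Fact p.Prime] (hp : Odd p) :
    legendreSym p (sunDet p 2 (-1)) = -1 ↔ p ≡ 5 [MOD 8] := by
  rw [legendreSym.eq_neg_one_iff]
  obtain ⟨k, hk⟩ := hp
  constructor
  · intro h
    by_contra h5
    have h5' : p % 8 ≠ 5 := h5
    apply h
    rcases (by omega : p % 4 = 3 ∨ p % 8 = 1) with h' | h'
    · exact isSquare_sunDet_of_mod_four_eq_three h'
    · exact isSquare_sunDet_of_mod_eight_eq_one h'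
  · exact fun h => not_isSquare_sunDet_of_mod_eight_eq_five h
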